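/- Let $n$ be a natural number and let $I=\{1,\dots,n\}$ be the set of players. For each $i\in I$ let $S_i$ be a nonempty finite set (the pure strategies of player $i$), put $S=\prod_{i\in I}S_i$, and let $g_i\colon S\to\mathbb{R}$ be any function (the payoff function of player $i$). A mixed strategy of player $i$ is a probability distribution on $S_i$; let $\Sigma_i$ be the set of all of them and $\Sigma=\prod_{i\in I}\Sigma_i$. For $\sigma=(\sigma_j)_{j\in I}\in\Sigma$ let $$f_i(\sigma)=\sum_{s\in S}\Big(\prod_{j\in I}\sigma_j(s_j)\Big)\,g_i(s)$$ be the expected payoff of player $i$, i.e. the extension of $g_i$ to $\Sigma$ that is linear in each player's strategy. Theorem. There is a Nash equilibrium, that is, a profile $\sigma\in\Sigma$ such that for every $i\in I$ there is no $\sigma'\in\Sigma$ with $\sigma'_j=\sigma_j$ for all $j\neq i$ and $f_i(\sigma')>f_i(\sigma)$. -/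

import Mathlib

/-- The set of mixed strategy profiles of `n` players, where player `i` has the finite set `S i`
of pure strategies: a profile assigns to each player a probability distribution on `S i`. -/
abbrev MixedProfile {n : ℕ} (S : Fin n → Type*) [∀ i, Fintype (S i)] : Type _ :=
  ∀ i : Fin n, stdSimplex ℝ (S i)

/-- The extension of a payoff function `g`, given on pure strategy profiles, to mixed strategy
profiles, linear in the strategy of each player: the expected value of `g` when the players draw
their pure strategies independently. -/
noncomputable def mixedPayoff {n : ℕ} {S : Fin n → Type*} [∀ i, Fintype (S i)]
    (g : (∀ i, S i) → ℝ) (σ : MixedProfile S) : ℝ :=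
  ∑ s : (∀ i, S i), (∏ i, (σ i : S i → ℝ) (s i)) * g s

/-- `σ` is a Nash equilibrium of the game with payoff functions `g i`: no player `i` can increase
the own payoff by a change of the own mixed strategy alone. -/
def IsNashEquilibrium {n : ℕ} {S : Fin n → Type*} [∀ i, Fintype (S i)]
    (g : Fin n → (∀ i, S i) → ℝ) (σ : MixedProfile S) : Prop :=
  ∀ i : Fin n, ¬ ∃ σ' : MixedProfile S,
    (∀ j, j ≠ i → σ j = σ' j) ∧ mixedPayoff (g i) σ' > mixedPayoff (g i) σ

/-! All players' pure strategies become the vertices of a single simplex. After scaling by `n`, a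
point of it gives every player nonnegative weights of total `n`, though a single player's mass need
not be 1. Let `A (i, s)` consist of the points where player `i` has mass at most 1 and `s` is a best
reply of `i`. These closed sets cover the simplex, since some player has mass at most 1. A KKM-type
theorem yields a point lying in `A p` for every `p` in its support. A player of mass above 1 would
have a strategy in the support, contradicting membership, so all masses equal 1, and only best
replies are played.

The KKM-type theorem follows by compactness from a colouring statement on finer and finer grids.
There Scarf's dominant sets take the place of the cells of a triangulation, and a parity count as in
Sperner's lemma finds one with all colours. -/

/-! ### Dominant sets and Scarf's lemma -/

open Finset in
/-- If `R` has as many elements as there are colours, then the number of facets of `R` that are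
coloured by exactly the colours different from `a` is odd if and only if `R` carries all colours. -/
theorem odd_card_facets_iff {V I : Type*} [DecidableEq V] [Fintype I] [DecidableEq I]
    (c : V → I) (a : I) {R : Finset V} (hR : #R = Fintype.card I) :
    Odd #{x ∈ R | (R.erase x).image c = univ.erase a} ↔ R.image c = univ := by
  constructor
  · intro h
    by_contra hne
    obtain ⟨x, hx⟩ := card_pos.1 h.pos
    rw [mem_filter] at hx
    obtain ⟨hxR, hxc⟩ := hx
    have hinj : Set.InjOn c (R.erase x : Finset V) := by
      rw [← card_image_iff, hxc, card_erase_of_mem (mem_univ a), card_erase_of_mem hxR, hR, card_univ]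
    have hxa : c x ≠ a := by
      rintro rfl
      apply hne
      rw [← insert_erase hxR, image_insert, hxc, insert_erase (mem_univ _)]
    -- Exactly one other point `z` repeats the colour of `x`, so the facets counted are those
    -- opposite `x` and `z`: an even number.
    obtain ⟨z, hz, hzc⟩ := mem_image.1 (hxc ▸ mem_erase.2 ⟨hxa, mem_univ _⟩ :
      c x ∈ (R.erase x).image c)
    have hzx : z ≠ x := (mem_erase.1 hz).1
    have hzR : z ∈ R := (mem_erase.1 hz).2
    have : {x ∈ R | (R.erase x).image c = univ.erase a} = {x, z} := by
      ext w
      simp only [mem_filter, mem_insert, mem_singleton]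
      constructor
      · rintro ⟨hw, hwc⟩
        by_contra! hwxz
        have hwe : w ∈ R.erase x := mem_erase.2 ⟨hwxz.1, hw⟩
        have : c w ∈ (R.erase w).image c := by
          rw [hwc, ← hxc]
          exact mem_image_of_mem c hwe
        obtain ⟨v, hv, hvc⟩ := mem_image.1 this
        rw [mem_erase] at hv
        by_cases hvx : v = x
        · subst hvx
          exact hwxz.2 (hinj hwe hz (by rw [hzc, hvc]))
        · exact hv.1 (hinj (mem_erase.2 ⟨hvx, hv.2⟩) hwe hvc)
      · rintro (rfl | rfl)
        · exact ⟨hxR, hxc⟩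
        · refine ⟨hzR, ?_⟩
          rw [← hxc]
          have h1 : R.erase w = insert x ((R.erase x).erase w) := by
            ext v; simp only [mem_erase, mem_insert]; grind
          conv_rhs => rw [← insert_erase hz]
          rw [h1, image_insert, image_insert, hzc]
    rw [this, card_pair hzx.symm] at h
    exact absurd h (by decide)
  · intro h
    have hinj : Set.InjOn c R := by rw [← card_image_iff, h, hR, card_univ]
    obtain ⟨x, hx, hxa⟩ := mem_image.1 (h ▸ mem_univ a : a ∈ R.image c)
    have : {x ∈ R | (R.erase x).image c = univ.erase a} = {x} := by
      ext w
      simp only [mem_filter, mem_singleton]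
      constructor
      · rintro ⟨hw, hwc⟩
        by_contra hwx
        have : c x ∈ (R.erase w).image c := mem_image_of_mem c (mem_erase.2 ⟨Ne.symm hwx, hx⟩)
        rw [hwc, hxa] at this
        exact (mem_erase.1 this).1 rfl
      · rintro rfl
        refine ⟨hx, ?_⟩
        ext i
        simp only [mem_image, mem_erase, mem_univ, and_true]
        constructor
        · rintro ⟨v, ⟨hv, hvR⟩, rfl⟩ hva
          exact hv (hinj hvR hx (hva.trans hxa.symm))
        · intro hi
          obtain ⟨v, hv, rfl⟩ := mem_image.1 (h ▸ mem_univ i : i ∈ R.image c)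
          exact ⟨v, ⟨by rintro rfl; exact hi hxa, hv⟩, rfl⟩
    rw [this, card_singleton]
    exact odd_one

/-- With respect to the preorders induced by the functions `r i`, the set `R` is *dominant* if no
point is, for all `i`, strictly above some element of `R`. -/
def Dominant {V I α : Type*} [LinearOrder α] (r : I → V → α) (R : Finset V) : Prop :=
  ∀ y, ∃ i, ∀ x ∈ R, r i y ≤ r i x

theorem Dominant.mono {V I α : Type*} [LinearOrder α] {r : I → V → α} {Q R : Finset V}
    (hR : Dominant r R) (h : Q ⊆ R) : Dominant r Q := fun y =>
  (hR y).imp fun _ hi x hx => hi x (h hx)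

open Finset in
/-- Let `Q` be a nonempty dominant set with one element less than there are orders, and suppose
that every `i` has a point that is above the `l`-minimum of `Q` for all `l ≠ i`. Then exactly two
points extend `Q` to a larger dominant set. -/
theorem Dominant.card_extensions_eq_two {V I α : Type*} [Fintype V] [DecidableEq V] [Fintype I]
    [DecidableEq I] [LinearOrder α] {r : I → V → α} (hr : ∀ i, Function.Injective (r i))
    {Q : Finset V} (hQ : Dominant r Q) (hcard : #Q + 1 = Fintype.card I) (hne : Q.Nonempty)
    (habove : ∀ k, ∃ y, ∀ l, l ≠ k → ∃ x ∈ Q, r l x < r l y)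
    (P : V → Prop) [DecidablePred P] (hP : ∀ y, P y ↔ y ∉ Q ∧ Dominant r (insert y Q)) :
    #{y | P y} = 2 := by
  choose q hqQ hq using fun i => exists_min_image Q (r i) hne
  have habove' : ∀ k, ∃ y, ∀ l, l ≠ k → r l (q l) < r l y := fun k =>
    (habove k).imp fun y hy l hl => by
      obtain ⟨x, hx, h⟩ := hy l hl
      exact (hq l x hx).trans_lt h
  have hqeq : ∀ i, ∀ x ∈ Q, r i x ≤ r i (q i) → x = q i := fun i x hx h =>
    hr i (le_antisymm h (hq i x hx))
  -- Dominance tested at a point of `Q` makes that point a minimum. With one more order than points,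
  -- exactly one pair of orders `i`, `j` shares its minimum.
  have hsurj : univ.image q = Q := by
    ext x
    simp only [mem_image, mem_univ, true_and]
    constructor
    · rintro ⟨i, rfl⟩
      exact hqQ i
    · intro hx
      obtain ⟨i, hi⟩ := hQ x
      exact ⟨i, (hqeq i x hx (hi _ (hqQ i))).symm⟩
  obtain ⟨i, j, hqij, hij⟩ : ∃ i j, q i = q j ∧ i ≠ j := by
    by_contra! h
    have : #(univ.image q) = Fintype.card I := card_image_of_injective _ fun i j => h i j
    rw [hsurj] at this
    omega
  have hrest : ∀ k, (k = i ∨ k = j) → (univ.erase k).image q = Q := by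
    intro k hk
    rw [← hsurj]
    refine (image_subset_image (erase_subset _ _)).antisymm fun x hx => ?_
    obtain ⟨l, -, rfl⟩ := mem_image.1 hx
    by_cases hl : l = k
    · subst hl
      rcases hk with rfl | rfl
      · exact mem_image.2 ⟨j, by simp [hij.symm], hqij.symm⟩
      · exact mem_image.2 ⟨i, by simp [hij], hqij⟩
    · exact mem_image_of_mem _ (by simp [hl])
  have hcoll : ∀ k l, k ≠ l → q k = q l → (k = i ∨ k = j) := by
    intro k l hkl h
    by_contra! hk
    have hinj : Set.InjOn q (univ.erase i : Finset I) := by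
      rw [← card_image_iff, hrest i (.inl rfl), card_erase_of_mem (mem_univ _), card_univ]
      omega
    by_cases hl : l = i
    · subst hl
      exact hk.2 (hinj (by simp [hk.1]) (by simp [hij.symm]) (h.trans hqij))
    · exact hkl (hinj (by simp [hk.1]) (by simp [hl]) h)
  -- the points that extend `Q` are the `k`-maxima of the following sets for `k = i` and `k = j`
  let M : I → Finset V := fun k => {y | ∀ l, l ≠ k → r l (q l) < r l y}
  have hM : ∀ k y, y ∈ M k ↔ ∀ l, l ≠ k → r l (q l) < r l y := fun k y => by simp [M]
  have hMne : ∀ k, (M k).Nonempty := fun k => (habove' k).imp fun y hy => (hM k y).2 hy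
  choose m hmM hm using fun k => exists_max_image (M k) (r k) (hMne k)
  have hMlow : ∀ k, ∀ y ∈ M k, r k y ≤ r k (q k) := by
    intro k y hy
    obtain ⟨l, hl⟩ := hQ y
    by_cases hlk : l = k
    · exact hlk ▸ hl _ (hqQ l)
    · exact absurd (hl _ (hqQ l)) (not_le.2 ((hM k y).1 hy l hlk))
  have hMQ : ∀ k, (k = i ∨ k = j) → ∀ y ∈ M k, y ∉ Q := by
    intro k hk y hy hyQ
    rw [← hrest k hk] at hyQ
    obtain ⟨l, hl, rfl⟩ := mem_image.1 hyQ
    exact lt_irrefl _ ((hM k _).1 hy l (by simpa using hl))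
  have hmP : ∀ k, (k = i ∨ k = j) → P (m k) := by
    intro k hk
    refine (hP _).2 ⟨hMQ k hk _ (hmM k), fun y => ?_⟩
    by_cases hy : ∀ l, l ≠ k → r l (q l) < r l y
    · have hyM := (hM k y).2 hy
      refine ⟨k, fun x hx => ?_⟩
      rcases mem_insert.1 hx with rfl | hx
      · exact hm k y hyM
      · exact (hMlow k y hyM).trans (hq k x hx)
    · push Not at hy
      obtain ⟨l, hl, hyl⟩ := hy
      refine ⟨l, fun x hx => ?_⟩
      rcases mem_insert.1 hx with rfl | hx
      · exact hyl.trans ((hM k _).1 (hmM k) l hl).le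
      · exact hyl.trans (hq l x hx)
  -- A common point would exceed the minimum of `Q` in every order, against dominance.
  have hmij : m i ≠ m j := by
    intro h
    obtain ⟨l, hl⟩ := hQ (m i)
    have hl := hl _ (hqQ l)
    by_cases hli : l = i
    · subst hli
      exact absurd ((hM j _).1 (hmM j) l hij) (by rw [← h]; exact not_lt.2 hl)
    · exact absurd ((hM i _).1 (hmM i) l hli) (not_lt.2 hl)
  have hPm : ∀ y, P y → y = m i ∨ y = m j := by
    intro y hy
    obtain ⟨hyQ, hy⟩ := (hP y).1 hy
    obtain ⟨k, hk⟩ := hy y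
    have hky : r k y < r k (q k) :=
      lt_of_le_of_ne (hk _ (mem_insert_of_mem (hqQ k))) fun h => hyQ (hr k h ▸ hqQ k)
    -- every element of `Q` is the minimum of `insert y Q` in some order, which is not `k`
    have hQk : ∀ x ∈ Q, ∃ l, l ≠ k ∧ x = q l ∧ r l x < r l y := by
      intro x hx
      obtain ⟨l, hl⟩ := hy x
      have hxy : r l x < r l y :=
        lt_of_le_of_ne (hl _ (mem_insert_self _ _)) fun h => hyQ (hr l h ▸ hx)
      refine ⟨l, ?_, hqeq l x hx (hl _ (mem_insert_of_mem (hqQ l))), hxy⟩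
      rintro rfl
      exact absurd hxy (not_lt.2 (hk _ (mem_insert_of_mem hx)))
    obtain ⟨l, hlk, hql, -⟩ := hQk _ (hqQ k)
    have hkij := hcoll k l hlk.symm hql
    have hinj : Set.InjOn q (univ.erase k : Finset I) := by
      rw [← card_image_iff, hrest k hkij, card_erase_of_mem (mem_univ _), card_univ]
      omega
    -- The minima `q l` with `l ≠ k` are distinct, so the order in which `q l` remains the minimum
    -- after adding `y` can only be `l`.
    have hyM : y ∈ M k := by
      refine (hM k y).2 fun l hl => ?_
      obtain ⟨l', hl', hq', hlt⟩ := hQk _ (hqQ l)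
      obtain rfl : l = l' := hinj (by simp [hl]) (by simp [hl']) hq'
      exact hlt
    have : y = m k := by
      refine hr k (le_antisymm (hm k y hyM) ?_)
      obtain ⟨l, hl⟩ := hy (m k)
      by_cases hlk : l = k
      · exact hlk ▸ hl _ (mem_insert_self _ _)
      · exact absurd (hl _ (mem_insert_of_mem (hqQ l))) (not_le.2 ((hM k _).1 (hmM k) l hlk))
    rcases hkij with rfl | rfl
    · exact .inl this
    · exact .inr this
  have : (univ.filter P) = {m i, m j} := by
    ext y
    simp only [mem_filter, mem_univ, true_and, mem_insert, mem_singleton]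
    refine ⟨hPm y, ?_⟩
    rintro (rfl | rfl)
    · exact hmP i (.inl rfl)
    · exact hmP j (.inr rfl)
  rw [this, card_pair hmij]

open Finset in
/-- **Scarf's lemma**, combinatorial form: let `V` be finite with linear orders indexed by `I` and
let `s i` be the least element in the order `i`, and above all ordinary points in the other orders.
If `V` is coloured by `I` with `s i` having colour `i`, then there is a dominant set
with exactly one point of each colour. -/
theorem exists_dominant_image_eq_univ {V I α : Type*} [Fintype V] [Fintype I]
    [DecidableEq I] [Nonempty I] [LinearOrder α] {r : I → V → α}
    (hr : ∀ i, Function.Injective (r i)) (s : I → V) (hmin : ∀ i v, r i (s i) ≤ r i v)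
    (hmax : ∀ i j v, i ≠ j → v ∉ Set.range s → r i v < r i (s j))
    (hT : ∃ v, v ∉ Set.range s) (c : V → I) (hc : ∀ i, c (s i) = i) :
    ∃ R : Finset V, Dominant r R ∧ R.image c = univ := by
  classical
  obtain ⟨a⟩ := ‹Nonempty I›
  have hs : Function.Injective s := fun i j h => by rw [← hc i, h, hc]
  -- Incidences of doors with rooms are counted twice. Every door lies in two rooms except `Q₀`,
  -- which lies in one, so the count is odd. Hence some room has an odd number of doors, which
  -- forces all colours.
  let rooms : Finset (Finset V) := {R | Dominant r R ∧ #R = Fintype.card I}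
  let doors : Finset (Finset V) :=
    {Q | Dominant r Q ∧ #Q + 1 = Fintype.card I ∧ Q.image c = univ.erase a}
  have hcI : #((univ : Finset I).erase a) + 1 = Fintype.card I := by
    rw [card_erase_add_one (mem_univ a), card_univ]
  have hroom : ∀ R ∈ rooms, #{Q ∈ doors | Q ⊆ R} =
      #{x ∈ R | (R.erase x).image c = univ.erase a} := by
    intro R hR
    obtain ⟨hRd, hRc⟩ := (mem_filter.1 hR).2
    symm
    refine card_bij (fun x _ => R.erase x) ?_ ?_ ?_
    · intro x hx
      obtain ⟨hxR, hxc⟩ := mem_filter.1 hx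
      refine mem_filter.2 ⟨mem_filter.2 ⟨mem_univ _, hRd.mono (erase_subset _ _), ?_, hxc⟩,
        erase_subset _ _⟩
      rw [card_erase_add_one hxR, hRc]
    · intro x hx y hy h
      exact (erase_inj _ (mem_filter.1 hx).1).1 h
    · intro Q hQ
      obtain ⟨hQ, hQR⟩ := mem_filter.1 hQ
      obtain ⟨-, -, hQc, hQa⟩ := mem_filter.1 hQ
      obtain ⟨x, hx, rfl⟩ : ∃ x ∉ Q, insert x Q = R :=
        Finset.covBy_iff_exists_insert.1 (covBy_iff_card_sdiff_eq_one.2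
          ⟨hQR, by rw [card_sdiff_of_subset hQR]; omega⟩)
      exact ⟨x, by simp [erase_insert hx, hQa], erase_insert hx⟩
  have hdoor : ∀ Q ∈ doors, #{R ∈ rooms | Q ⊆ R} =
      #{y | y ∉ Q ∧ Dominant r (insert y Q)} := by
    intro Q hQ
    obtain ⟨-, -, hQc, hQa⟩ := mem_filter.1 hQ
    symm
    refine card_bij (fun x _ => insert x Q) ?_ ?_ ?_
    · intro x hx
      obtain ⟨-, hxQ, hd⟩ := mem_filter.1 hx
      refine mem_filter.2 ⟨mem_filter.2 ⟨mem_univ _, hd, ?_⟩, subset_insert _ _⟩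
      rw [card_insert_of_notMem hxQ, hQc]
    · intro x hx y hy h
      exact (insert_inj (mem_filter.1 hx).2.1).1 h
    · intro R hR
      obtain ⟨hR, hQR⟩ := mem_filter.1 hR
      obtain ⟨-, hRd, hRc⟩ := mem_filter.1 hR
      obtain ⟨x, hx, rfl⟩ : ∃ x ∉ Q, insert x Q = R :=
        Finset.covBy_iff_exists_insert.1 (covBy_iff_card_sdiff_eq_one.2
          ⟨hQR, by rw [card_sdiff_of_subset hQR]; omega⟩)
      exact ⟨x, by simp [hx, hRd], rfl⟩
  let Q₀ : Finset V := (univ.erase a).image s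
  have hQ₀ : Q₀ ∈ doors := by
    refine mem_filter.2 ⟨mem_univ _, fun y => ?_, ?_, ?_⟩
    · by_cases hy : y ∈ Set.range s
      · obtain ⟨i, rfl⟩ := hy
        exact ⟨i, fun x _ => hmin i x⟩
      · refine ⟨a, fun x hx => ?_⟩
        obtain ⟨j, hj, rfl⟩ := mem_image.1 hx
        exact (hmax a j y (by rintro rfl; simp at hj) hy).le
    · rw [card_image_of_injective _ hs, hcI]
    · rw [image_image, show c ∘ s = id from funext hc, image_id]
  have hslack : ∀ Q ∈ doors, (∀ x ∈ Q, x ∈ Set.range s) → Q = Q₀ := by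
    intro Q hQ h
    have hQa := (mem_filter.1 hQ).2.2.2
    ext x
    rw [mem_image]
    constructor
    · intro hx
      obtain ⟨i, rfl⟩ := h x hx
      refine ⟨i, ?_, rfl⟩
      rw [← hQa]
      exact mem_image.2 ⟨_, hx, hc i⟩
    · rintro ⟨i, hi, rfl⟩
      rw [← hQa] at hi
      obtain ⟨y, hy, rfl⟩ := mem_image.1 hi
      obtain ⟨j, rfl⟩ := h y hy
      rwa [hc]
  have hinner : ∀ Q ∈ doors, Q ≠ Q₀ → #{y | y ∉ Q ∧ Dominant r (insert y Q)} = 2 := by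
    intro Q hQ hne
    obtain ⟨-, hQd, hQc, hQa⟩ := mem_filter.1 hQ
    obtain ⟨x, hxQ, hxs⟩ : ∃ x ∈ Q, x ∉ Set.range s := by
      by_contra! h
      exact hne (hslack Q hQ h)
    exact hQd.card_extensions_eq_two hr hQc ⟨x, hxQ⟩
      (fun k => ⟨s k, fun l hl => ⟨x, hxQ, hmax l k x hl hxs⟩⟩) _ fun _ => Iff.rfl
  -- The only extension of `Q₀` is by the ordinary point that is largest in the order `a`; adding `s
  -- a` would leave ordinary points undominated.
  have houter : #{y | y ∉ Q₀ ∧ Dominant r (insert y Q₀)} = 1 := by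
    have hTne : ({v | v ∉ Set.range s} : Finset V).Nonempty := by
      obtain ⟨v, hv⟩ := hT
      exact ⟨v, mem_filter.2 ⟨mem_univ _, hv⟩⟩
    obtain ⟨t, ht, htmax⟩ := exists_max_image _ (r a) hTne
    replace ht := (mem_filter.1 ht).2
    replace htmax : ∀ y, y ∉ Set.range s → r a y ≤ r a t := fun y hy =>
      htmax y (mem_filter.2 ⟨mem_univ _, hy⟩)
    rw [card_eq_one]
    refine ⟨t, ?_⟩
    -- an ordinary point can only be dominated in the order `a`
    have key : ∀ y z, z ∉ Set.range s → Dominant r (insert y Q₀) → r a z ≤ r a y := by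
      intro y z hz hd
      obtain ⟨i, hi⟩ := hd z
      by_cases hia : i = a
      · subst hia
        exact hi _ (mem_insert_self _ _)
      · have := hi (s i) (mem_insert_of_mem (mem_image_of_mem _ (by simp [hia])))
        exact absurd ⟨i, hr i (le_antisymm (hmin i z) this)⟩ hz
    ext y
    simp only [mem_filter, mem_univ, true_and, mem_singleton]
    constructor
    · rintro ⟨hy, hd⟩
      have hty := key y t ht hd
      have hys : y ∉ Set.range s := by
        rintro ⟨i, rfl⟩
        by_cases hia : i = a
        · subst hia
          exact ht ⟨i, hr i (le_antisymm (hmin i t) hty)⟩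
        · exact hy (mem_image_of_mem _ (by simp [hia]))
      exact hr a (le_antisymm (htmax y hys) hty)
    · rintro rfl
      refine ⟨fun h => ?_, fun z => ?_⟩
      · obtain ⟨i, -, rfl⟩ := mem_image.1 h
        exact ht ⟨i, rfl⟩
      · by_cases hz : z ∈ Set.range s
        · obtain ⟨i, rfl⟩ := hz
          exact ⟨i, fun x _ => hmin i x⟩
        · refine ⟨a, fun x hx => ?_⟩
          rcases mem_insert.1 hx with rfl | hx
          · exact htmax z hz
          · obtain ⟨j, hj, rfl⟩ := mem_image.1 hx
            exact (hmax a j z (by rintro rfl; simp at hj) hz).le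
  have hcount : ∑ R ∈ rooms, #{Q ∈ doors | Q ⊆ R} = ∑ Q ∈ doors, #{R ∈ rooms | Q ⊆ R} :=
    (sum_card_bipartiteAbove_eq_sum_card_bipartiteBelow (fun Q R : Finset V => Q ⊆ R)).symm
  have hodd : Odd (∑ Q ∈ doors, #{R ∈ rooms | Q ⊆ R}) := by
    rw [← add_sum_erase _ _ hQ₀, hdoor _ hQ₀, houter]
    refine odd_one.add_even (even_sum _ fun Q hQ => ?_)
    obtain ⟨hne, hQ⟩ := mem_erase.1 hQ
    rw [hdoor Q hQ, hinner Q hQ hne]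
    exact even_two
  rw [← hcount] at hodd
  obtain ⟨R, hR, hRodd⟩ : ∃ R ∈ rooms, Odd #{Q ∈ doors | Q ⊆ R} := by
    by_contra! h
    exact Nat.not_even_iff_odd.2 hodd (even_sum _ fun R hR => Nat.not_odd_iff_even.1 (h R hR))
  obtain ⟨-, hRd, hRc⟩ := mem_filter.1 hR
  rw [hroom R hR] at hRodd
  exact ⟨R, hRd, (odd_card_facets_iff c a hRc).1 hRodd⟩

/-! ### Colourings of the integer grid -/

open Finset in
/-- For every colouring of the points of the grid `{x : I → ℕ | ∑ i, x i = m}` by `I` there is a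
grid point such that each of its coordinates that is not small is the colour of a nearby point. -/
theorem exists_grid_point_near_colors {I : Type*} [Fintype I] [Nonempty I]
    (m : ℕ) (c : (I → ℕ) → I) :
    ∃ x : I → ℕ, ∑ i, x i = m ∧ ∀ i, x i ≤ Fintype.card I ∨
      ∃ y : I → ℕ, ∑ j, y j = m ∧ c y = i ∧
        ∀ j, x j ≤ y j + Fintype.card I ∧ y j ≤ x j + Fintype.card I := by
  classical
  let T : Finset (I → ℕ) := univ.piAntidiag m
  have hT : ∀ x : T, ∑ i, x.1 i = m := fun x => (mem_piAntidiag.1 x.2).1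
  have hTle : ∀ (x : T) i, x.1 i ≤ m := fun x i =>
    (hT x) ▸ single_le_sum (fun j _ => Nat.zero_le (x.1 j)) (mem_univ i)
  -- Grid points take values from 1 to `m + 1`, leaving 0 and `m + 2` for the slack points strictly
  -- below and above them. The second component of `r` breaks ties.
  let p : I → T ⊕ I → ℕ := fun i => Sum.elim (fun x => x.1 i + 1) fun j => if j = i then 0 else m + 2
  let r : I → T ⊕ I → ℕ ×ₗ Fin (Fintype.card (T ⊕ I)) := fun i v =>
    toLex (p i v, Fintype.equivFin _ v)
  have hrp : ∀ i v w, r i v ≤ r i w → p i v ≤ p i w := fun i v w h => by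
    rcases (Prod.Lex.toLex_le_toLex.1 h) with h | h
    · exact h.le
    · exact h.1.le
  have hpr : ∀ i v w, p i v < p i w → r i v < r i w := fun i v w h =>
    Prod.Lex.toLex_lt_toLex.2 (.inl h)
  have ⟨x₀, hx₀⟩ : ∃ x : I → ℕ, x ∈ T := by
    obtain ⟨a⟩ := ‹Nonempty I›
    exact ⟨Pi.single a m, by simp [T, mem_piAntidiag]⟩
  obtain ⟨R, hRd, hRc⟩ := exists_dominant_image_eq_univ (r := r)
    (fun i v w h => (Fintype.equivFin _).injective (Prod.ext_iff.1 (toLex.injective h)).2)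
    Sum.inr
    (by
      rintro i (x | j)
      · exact (hpr i _ _ (by simp [p])).le
      · by_cases h : j = i
        · rw [h]
        · exact (hpr i _ _ (by simp [p, h])).le)
    (by
      rintro i j (x | k) hij hv
      · apply hpr
        have := hTle x i
        simp only [p, Sum.elim_inl, Sum.elim_inr, if_neg hij.symm]
        omega
      · exact absurd ⟨k, rfl⟩ hv)
    ⟨.inl ⟨x₀, hx₀⟩, by simp⟩ (Sum.elim (fun x => c x.1) id) (fun i => rfl)
  have hcol : ∀ i, .inr i ∈ R ∨ ∃ x : T, .inl x ∈ R ∧ c x.1 = i := by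
    intro i
    obtain ⟨v, hv, hvi⟩ := mem_image.1 (hRc ▸ mem_univ i)
    rcases v with x | j
    · exact .inr ⟨x, hv, hvi⟩
    · exact .inl (by simpa using hvi ▸ hv)
  have hRne : R.Nonempty := by
    obtain ⟨a⟩ := ‹Nonempty I›
    rcases hcol a with h | ⟨x, h, -⟩ <;> exact ⟨_, h⟩
  choose q hqR hq using fun i => exists_min_image R (p i) hRne
  have hdom : ∀ y : T, ∃ i, y.1 i < p i (q i) := fun y => by
    obtain ⟨i, hi⟩ := hRd (.inl y)
    exact ⟨i, hrp _ _ _ (hi _ (hqR i))⟩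
  -- Otherwise the minima, with the surplus added to one coordinate, would form a grid point
  -- violating `hdom`.
  have hsum : m < ∑ i, p i (q i) := by
    by_contra! h
    obtain ⟨a⟩ := ‹Nonempty I›
    let y : I → ℕ := fun i => p i (q i) + Pi.single (M := fun _ => ℕ) a (m - ∑ i, p i (q i)) i
    have hy : ∑ i, y i = m := by
      simp only [y, sum_add_distrib, sum_pi_single', mem_univ, if_true]
      omega
    obtain ⟨i, hi⟩ := hdom ⟨y, mem_piAntidiag.2 ⟨hy, by simp⟩⟩
    simp only [y] at hi
    omega
  -- The numbers `x i + 1` sum to `m + card I` and bound the minima, whose sum exceeds `m`; so no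
  -- coordinate can differ by more than `card I`.
  have hclose : ∀ x : T, .inl x ∈ R → ∀ i, p i (q i) ≤ x.1 i + 1 ∧
      x.1 i + 1 ≤ p i (q i) + Fintype.card I := by
    intro x hx i
    have hle : ∀ i, p i (q i) ≤ x.1 i + 1 := fun i => hq i _ hx
    refine ⟨hle i, ?_⟩
    have h1 : ∑ j, (x.1 j + 1) = m + Fintype.card I := by
      rw [sum_add_distrib, hT x]; simp
    rw [← add_sum_erase _ _ (mem_univ i)] at h1 hsum
    have h2 : ∑ j ∈ univ.erase i, p j (q j) ≤ ∑ j ∈ univ.erase i, (x.1 j + 1) :=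
      sum_le_sum fun j _ => hle j
    omega
  -- Without grid points `R` would contain every slack point, all minima would be 0, and `x₀` would
  -- not be dominated.
  obtain ⟨x, hx⟩ : ∃ x : T, .inl x ∈ R := by
    by_contra! h
    obtain ⟨i, hi⟩ := hdom ⟨x₀, hx₀⟩
    rcases hcol i with h' | ⟨x, h', -⟩
    · have := hq i _ h'
      simp only [p, Sum.elim_inr, if_true] at this hi
      omega
    · exact h x h'
  refine ⟨x.1, hT x, fun i => ?_⟩
  rcases hcol i with h | ⟨y, hy, hyi⟩
  -- The slack point of `i` makes the `i`-minimum 0, so `hclose` bounds `x i`.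
  · left
    have h1 := hq i _ h
    have h2 := (hclose x hx i).2
    simp only [p, Sum.elim_inr, if_true] at h1 h2
    omega
  · refine .inr ⟨y.1, hT y, hyi, fun j => ?_⟩
    have h1 := hclose x hx j
    have h2 := hclose y hy j
    omega

/-! ### From the grid to a covering theorem by compactness -/

open Filter Topology in
/-- A covering theorem of Knaster–Kuratowski–Mazurkiewicz type: if closed sets `A i` cover the
standard simplex, then some point of the simplex lies in `A i` for every `i` in its support. -/
theorem exists_mem_stdSimplex_forall_mem_of_cover {I : Type*} [Fintype I] [Nonempty I]
    (A : I → Set (I → ℝ)) (hA : ∀ i, IsClosed (A i))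
    (hcov : ∀ x ∈ stdSimplex ℝ I, ∃ i, x ∈ A i) :
    ∃ x ∈ stdSimplex ℝ I, ∀ i, x i = 0 ∨ x ∈ A i := by
  let N : ℝ := Fintype.card I
  let sc : ℕ → (I → ℕ) → I → ℝ := fun k x i => x i / (k + 1 : ℝ)
  have hsc : ∀ k x, ∑ i, x i = k + 1 → sc k x ∈ stdSimplex ℝ I := by
    intro k x hx
    refine ⟨fun i => by positivity, ?_⟩
    rw [← Finset.sum_div, div_eq_one_iff_eq (by positivity)]
    exact_mod_cast hx
  -- Each grid point is coloured by the index of a closed set containing it.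
  have hcol : ∀ k : ℕ, ∃ c : (I → ℕ) → I, ∀ x, ∑ i, x i = k + 1 → sc k x ∈ A (c x) := by
    intro k
    have : ∀ x : I → ℕ, ∃ i, ∑ i, x i = k + 1 → sc k x ∈ A i := by
      intro x
      by_cases hx : ∑ i, x i = k + 1
      · exact (hcov _ (hsc k x hx)).imp fun _ h _ => h
      · exact ⟨Classical.arbitrary I, fun h => absurd h hx⟩
    exact ⟨_, fun x => (this x).choose_spec⟩
  choose c hc using hcol
  choose x hx hnear using fun k => exists_grid_point_near_colors (k + 1) (c k)
  obtain ⟨z, hz, φ, hφ, hlim⟩ :=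
    (isCompact_stdSimplex ℝ I).tendsto_subseq fun k => hsc k (x k) (hx k)
  have hsmall : Tendsto (fun k => N / ((φ k : ℝ) + 1)) atTop (𝓝 0) := by
    refine (tendsto_const_nhds (x := N)).div_atTop ?_
    exact tendsto_atTop_add_const_right _ _ (tendsto_natCast_atTop_atTop.comp hφ.tendsto_atTop)
  refine ⟨z, hz, fun i => ?_⟩
  by_contra! h
  obtain ⟨hzi, hzA⟩ := h
  have hlimi : Tendsto (fun k => sc (φ k) (x (φ k)) i) atTop (𝓝 (z i)) :=
    (continuous_apply i).continuousAt.tendsto.comp hlim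
  have hpos : 0 < z i := lt_of_le_of_ne (hz.1 i) (Ne.symm hzi)
  -- A ball around `z` misses `A i`. For large `k` coordinate `i` is not small, so the grid gives a
  -- point of colour `i`, hence of `A i`, inside that ball.
  obtain ⟨ε, hε, hball⟩ := Metric.isOpen_iff.1 (hA i).isOpen_compl z hzA
  have h1 : ∀ᶠ k in atTop, N / ((φ k : ℝ) + 1) < sc (φ k) (x (φ k)) i :=
    hsmall.eventually_lt hlimi hpos
  have h2 : ∀ᶠ k in atTop, dist (sc (φ k) (x (φ k))) z < ε / 2 :=
    hlim.eventually (Metric.ball_mem_nhds z (half_pos hε))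
  have h3 : ∀ᶠ k in atTop, N / ((φ k : ℝ) + 1) < ε / 2 :=
    hsmall.eventually_lt_const (half_pos hε)
  obtain ⟨k, h1, h2, h3⟩ := (h1.and (h2.and h3)).exists
  have hk : (0 : ℝ) < φ k + 1 := by positivity
  rcases hnear (φ k) i with h | ⟨y, hy, hyi, hxy⟩
  · have : (x (φ k) i : ℝ) ≤ N := Nat.cast_le.2 h
    exact absurd h1 (not_lt.2 (div_le_div_of_nonneg_right this hk.le))
  · have hd : dist (sc (φ k) y) (sc (φ k) (x (φ k))) ≤ N / ((φ k : ℝ) + 1) := by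
      refine (dist_pi_le_iff (by positivity)).2 fun j => ?_
      rw [Real.dist_eq, ← sub_div, abs_div, abs_of_pos hk]
      refine div_le_div_of_nonneg_right ?_ hk.le
      have h4 : (x (φ k) j : ℝ) ≤ y j + (Fintype.card I : ℝ) := by exact_mod_cast (hxy j).1
      have h5 : (y j : ℝ) ≤ x (φ k) j + (Fintype.card I : ℝ) := by exact_mod_cast (hxy j).2
      exact abs_sub_le_iff.2 ⟨by linarith, by linarith⟩
    have hyA : sc (φ k) y ∈ A i := hyi ▸ hc (φ k) y hy
    refine hball (Metric.mem_ball.2 ?_) hyA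
    linarith [dist_triangle (sc (φ k) y) (sc (φ k) (x (φ k))) z]

/-! ### Multilinear payoffs and the equilibrium -/

/-- The expected payoff, as a multilinear function of arbitrary weights on the pure strategies. -/
noncomputable def payoffMultilinear {n : ℕ} {S : Fin n → Type*} [∀ i, Fintype (S i)]
    (g : (∀ i, S i) → ℝ) : MultilinearMap ℝ (fun i => S i → ℝ) ℝ :=
  ∑ s : (∀ i, S i), g s •
    (MultilinearMap.mkPiAlgebra ℝ (Fin n) ℝ).compLinearMap fun i => LinearMap.proj (s i)

theorem payoffMultilinear_apply {n : ℕ} {S : Fin n → Type*} [∀ i, Fintype (S i)]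
    (g : (∀ i, S i) → ℝ) (y : ∀ i, S i → ℝ) :
    payoffMultilinear g y = ∑ s : (∀ i, S i), (∏ i, y i (s i)) * g s := by
  simp [payoffMultilinear, mul_comm]

theorem mixedPayoff_eq_payoffMultilinear {n : ℕ} {S : Fin n → Type*} [∀ i, Fintype (S i)]
    (g : (∀ i, S i) → ℝ) (σ : MixedProfile S) :
    mixedPayoff g σ = payoffMultilinear g fun i => (σ i : S i → ℝ) :=
  (payoffMultilinear_apply g _).symm

theorem continuous_payoffMultilinear {n : ℕ} {S : Fin n → Type*} [∀ i, Fintype (S i)]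
    (g : (∀ i, S i) → ℝ) : Continuous (payoffMultilinear g) := by
  simp only [funext (payoffMultilinear_apply g)]
  fun_prop

/-- The payoff is the mean of the payoffs of the pure strategies of a player. -/
theorem payoffMultilinear_update {n : ℕ} {S : Fin n → Type*} [∀ i, Fintype (S i)]
    [∀ i, DecidableEq (S i)] (g : (∀ i, S i) → ℝ) (y : ∀ i, S i → ℝ) (i : Fin n) (z : S i → ℝ) :
    payoffMultilinear g (Function.update y i z) =
      ∑ t, z t * payoffMultilinear g (Function.update y i (Pi.single t 1)) := by
  conv_lhs => rw [pi_eq_sum_univ' z]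
  rw [MultilinearMap.map_update_sum]
  refine Finset.sum_congr rfl fun t _ => ?_
  rw [MultilinearMap.map_update_smul, smul_eq_mul]

/-- A profile in which every player uses only pure strategies that are best replies is a Nash
equilibrium. -/
theorem isNashEquilibrium_of_support_best_reply {n : ℕ} {S : Fin n → Type*} [∀ i, Fintype (S i)]
    [∀ i, DecidableEq (S i)] (g : Fin n → (∀ i, S i) → ℝ) (y : ∀ i, S i → ℝ)
    (hy : ∀ i, y i ∈ stdSimplex ℝ (S i))
    (hbest : ∀ i s, y i s = 0 ∨ ∀ t, payoffMultilinear (g i) (Function.update y i (Pi.single t 1)) ≤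
      payoffMultilinear (g i) (Function.update y i (Pi.single s 1))) :
    IsNashEquilibrium g fun i => ⟨y i, hy i⟩ := by
  rintro i ⟨σ', hσ', hlt⟩
  rw [mixedPayoff_eq_payoffMultilinear, mixedPayoff_eq_payoffMultilinear, gt_iff_lt,
    ← not_le] at hlt
  apply hlt
  have h1 : (fun j => (σ' j : S j → ℝ)) = Function.update y i (σ' i : S i → ℝ) := by
    ext1 j
    by_cases hj : j = i
    · subst hj; simp
    · rw [Function.update_of_ne hj, ← hσ' j hj]; rfl
  have h2 : (fun j => ((⟨y j, hy j⟩ : stdSimplex ℝ (S j)) : S j → ℝ)) =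
      Function.update y i (y i) := (Function.update_eq_self i y).symm
  rw [h1, h2, payoffMultilinear_update, payoffMultilinear_update (z := y i)]
  set U := fun t => payoffMultilinear (g i) (Function.update y i (Pi.single t 1))
  obtain ⟨s, hs⟩ : ∃ s, y i s ≠ 0 := by
    by_contra! h
    have := (hy i).2
    simp [h] at this
  have hsU : ∀ t, U t ≤ U s := (hbest i s).resolve_left hs
  -- A mean of the `U t` is at most their maximum `U s`, and `y i` attains it because it charges
  -- only maximizers.
  calc ∑ t, (σ' i : S i → ℝ) t * U t ≤ ∑ t, (σ' i : S i → ℝ) t * U s :=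
        Finset.sum_le_sum fun t _ => mul_le_mul_of_nonneg_left (hsU t) ((σ' i).2.1 t)
    _ = ∑ t, y i t * U s := by
        rw [← Finset.sum_mul, ← Finset.sum_mul, (hy i).2]
        exact congrArg (· * U s) (σ' i).2.2
    _ ≤ ∑ t, y i t * U t := Finset.sum_le_sum fun t _ => by
        rcases hbest i t with h | h
        · simp [h]
        · exact mul_le_mul_of_nonneg_left (h s) ((hy i).1 t)

theorem mainTheorem1 {n : ℕ} (S : Fin n → Type*) [∀ i, Fintype (S i)] [∀ i, Nonempty (S i)]
    (g : Fin n → (∀ i, S i) → ℝ) :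
    ∃ σ : MixedProfile S, IsNashEquilibrium g σ := by
  classical
  -- Without players the joint simplex has no vertices and is empty, so this case is separate.
  rcases Nat.eq_zero_or_pos n with rfl | hn
  · exact ⟨fun i => i.elim0, fun i => i.elim0⟩
  have hn' : (0 : ℝ) < n := Nat.cast_pos.2 hn
  have : Nonempty (Σ i, S i) := ⟨⟨⟨0, hn⟩, Classical.arbitrary _⟩⟩
  -- The factor `n` makes the players' masses average to 1.
  let Y : ((Σ i, S i) → ℝ) → ∀ i, S i → ℝ := fun x i s => n * x ⟨i, s⟩
  let U : ∀ i, S i → ((Σ i, S i) → ℝ) → ℝ := fun i s x =>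
    payoffMultilinear (g i) (Function.update (Y x) i (Pi.single s 1))
  have hY : Continuous Y := by fun_prop
  have hU : ∀ i s, Continuous (U i s) := fun i s =>
    (continuous_payoffMultilinear (g i)).comp (hY.update i continuous_const)
  have hsum : ∀ x ∈ stdSimplex ℝ (Σ i, S i), ∑ i, ∑ s, Y x i s = ∑ _i : Fin n, 1 := by
    intro x hx
    simp only [Y, ← Finset.mul_sum]
    rw [← Fintype.sum_sigma', hx.2]
    simp
  -- The mass condition is what later forces every player's weights to sum to exactly 1.
  let A : (Σ i, S i) → Set ((Σ i, S i) → ℝ) := fun p =>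
    {x | ∑ s, Y x p.1 s ≤ 1} ∩ ⋂ t, {x | U p.1 t x ≤ U p.1 p.2 x}
  obtain ⟨x, hx, hxA⟩ := exists_mem_stdSimplex_forall_mem_of_cover A
    (fun p => (isClosed_le (by fun_prop) continuous_const).inter
      (isClosed_iInter fun t => isClosed_le (hU _ _) (hU _ _)))
    (by
      intro x hx
      obtain ⟨i, -, hi⟩ := Finset.exists_le_of_sum_le ⟨⟨0, hn⟩, Finset.mem_univ _⟩ (hsum x hx).le
      obtain ⟨s, hs⟩ := Finite.exists_max fun s => U i s x
      exact ⟨⟨i, s⟩, hi, Set.mem_iInter.2 hs⟩)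
  have hle : ∀ i, ∑ s, Y x i s ≤ 1 := by
    intro i
    by_contra! h
    obtain ⟨s, -, hs⟩ : ∃ s ∈ Finset.univ, Y x i s ≠ 0 :=
      Finset.exists_ne_zero_of_sum_ne_zero (zero_lt_one.trans h).ne'
    rcases hxA ⟨i, s⟩ with h0 | h1
    · exact hs (by simp [Y, h0])
    · exact absurd h1.1 (not_le.2 h)
  have heq : ∀ i, ∑ s, Y x i s = 1 := fun i =>
    (Finset.sum_eq_sum_iff_of_le fun i _ => hle i).1 (hsum x hx) i (Finset.mem_univ i)
  refine ⟨_, isNashEquilibrium_of_support_best_reply g (Y x)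
    (fun i => ⟨fun s => mul_nonneg hn'.le (hx.1 _), heq i⟩) fun i s => ?_⟩
  rcases hxA ⟨i, s⟩ with h0 | h1
  · exact .inl (by simp [Y, h0])
  · exact .inr fun t => Set.mem_iInter.1 h1.2 t
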